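/- Let $n$ be a natural number, let $\mathbb F$ be a field and let $A$ be an $n\times n$ matrix over $\mathbb F$. For $S,T\subseteq[n]=\{1,\dots,n\}$, let $A[S,T]$ be the submatrix of $A$ with rows indexed by $S$ and columns indexed by $T$, let $A[S]=A[S,S]$, and let $\overline S$ be the complement of $S$ in the index set. We use the following notions. * Two square matrices $M,N$ over $\mathbb F$ with the same index set are *principal minor equivalent* (PME) if $\det M[S]=\det N[S]$ for every nonempty subset $S$ of the index set. * A set $X$ of indices of an $m\times m$ matrix $M$ is a *cut* of $M$ if $2\le |X|\le m-2$ and both $M[X,\overline X]$ and $M[\overline X,X]$ have rank at most $1$. * $A$ has *property $\mathcal R$* if all its off-diagonal entries are nonzero and, for any four distinct $i,j,k,\ell\in[n]$ with $\operatorname{rank}A[\{i,j\},\{k,\ell\}]=1$, there is $X\subseteq[n]$ with $i,j\in X$, $k,\ell\in\overline X$ and $\operatorname{rank}A[X,\overline X]=1$. * A set $S\subseteq[n]$ with $2\le|S|\le n-2$ is *plausible* for $A$ if for all two-element sets $\{i,j\}\subseteq S$ and $\{k,\ell\}\subseteq\overline S$ there is a $4\times4$ matrix over $\mathbb F$, indexed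 by $\{i,j,k,\ell\}$, that is PME to $A[\{i,j,k,\ell\}]$ and has $\{i,j\}$ as a cut. **Lemma.** Suppose that $A$ has property $\mathcal R$. Then a set $S\subseteq[n]$ is plausible for $A$ if and only if $S$ is a cut of some $n\times n$ matrix $C$ over $\mathbb F$ that is PME to $A$. -/

import Mathlib

/-- The submatrix `A[S, T]` with rows indexed by `S` and columns indexed by `T`. -/
def block {V F : Type*} (A : Matrix V V F) (S T : Finset V) : Matrix S T F :=
  A.submatrix (fun s : S => (s : V)) (fun t : T => (t : V))

/-- The principal submatrix `A[S] = A[S, S]`. -/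
def principal {V F : Type*} (A : Matrix V V F) (S : Finset V) : Matrix S S F :=
  block A S S

/-- Principal minor equivalence: all corresponding principal minors are equal (for `S = ∅` the
equation reads `1 = 1`). -/
def PME {V F : Type*} [DecidableEq V] [Field F] (A B : Matrix V V F) : Prop :=
  ∀ S : Finset V, (principal A S).det = (principal B S).det

/-- All off-diagonal entries are nonzero. -/
def IsDense {V F : Type*} [Field F] (A : Matrix V V F) : Prop :=
  ∀ i j : V, i ≠ j → A i j ≠ 0

/-- The rank-one extension property. -/
def RankOneExtension {V F : Type*} [Fintype V] [DecidableEq V] [Field F]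
    (A : Matrix V V F) : Prop :=
  ∀ i j k l : V, [i, j, k, l].Nodup → (block A {i, j} {k, l}).rank = 1 →
    ∃ X : Finset V, i ∈ X ∧ j ∈ X ∧ k ∈ Xᶜ ∧ l ∈ Xᶜ ∧ (block A X Xᶜ).rank = 1

/-- Property `R`: dense, with the rank-one extension property. -/
def PropertyR {V F : Type*} [Fintype V] [DecidableEq V] [Field F] (A : Matrix V V F) : Prop :=
  IsDense A ∧ RankOneExtension A

/-- `X` is a cut of `A`: `2 ≤ |X| ≤ n - 2` (so that `n ≥ 4`), and both `A[X, Xᶜ]` and `A[Xᶜ, X]`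
have rank at most one. -/
def IsCut {V F : Type*} [Fintype V] [DecidableEq V] [Field F]
    (A : Matrix V V F) (X : Finset V) : Prop :=
  2 ≤ X.card ∧ X.card + 2 ≤ Fintype.card V ∧
    (block A X Xᶜ).rank ≤ 1 ∧ (block A Xᶜ X).rank ≤ 1

/-- For distinct `i, j, k, l`, the pair of pairs `{{i, j}, {k, l}}` satisfies property `P`: some
matrix `C` indexed by `{i, j, k, l}` is principal minor equivalent to `A[{i, j, k, l}]` and has
`{i, j}`, seen as a set of indices of `C`, as a cut. -/
def PropertyP {V F : Type*} [DecidableEq V] [Field F]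
    (A : Matrix V V F) (i j k l : V) : Prop :=
  ∃ C : Matrix ({i, j, k, l} : Finset V) ({i, j, k, l} : Finset V) F,
    PME C (principal A {i, j, k, l}) ∧
      IsCut C (({i, j} : Finset V).subtype (fun v => v ∈ ({i, j, k, l} : Finset V)))

/-- `S` is a plausible set for `A`: `2 ≤ |S| ≤ n - 2`, and for all two-element sets
`{i, j} ⊆ S` and `{k, l} ⊆ Sᶜ`, the pair `{{i, j}, {k, l}}` satisfies property `P`. -/
def IsPlausible {V F : Type*} [Fintype V] [DecidableEq V] [Field F]
    (A : Matrix V V F) (S : Finset V) : Prop :=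
  2 ≤ S.card ∧ S.card + 2 ≤ Fintype.card V ∧
    ∀ i ∈ S, ∀ j ∈ S, ∀ k ∈ Sᶜ, ∀ l ∈ Sᶜ, i ≠ j → k ≠ l → PropertyP A i j k l

/-! Write `ij|kl` for the partition of four indices into the pairs `{i, j}` and `{k, l}`. A cut of a
matrix restricts to its principal submatrices, which gives one direction. For the other, fix `i ∈ S`
and `k ∉ S` and keep the entries of `A` on `S ∪ {k}` and on `Sᶜ ∪ {i}`. The rank conditions then
force the remaining entries; the result is `cutMatrix A S i k`, and the task is to show that it is
PME to `A`.

Three facts carry this. First, in a dense matrix property `P` for `ij|kl` means that either `ij|kl`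
is a cut of the `4 × 4` submatrix of `A` itself, or both other partitions are (`quartet_dichotomy`).
Secondly, a minor across a cut is determined by minors that reach at most one index beyond a side
(`pminor_cut`), so PME can be checked on smaller sets (`pminor_union_eq`). Thirdly, the principal
minors of `cutMatrix A S i k` do not depend on `i` and `k` (`cutMatrix_base`).

The proof is an induction on the index set `T` of the minor. Move `i` and `k` into `T`, and join `x
∈ S` to `y ∉ S` when `ix|ky` is not a cut. Without edges in `T` the two matrices agree on `T`.
Otherwise a component with an edge in `T` has rank at most one against its complement in `A`, both
ways, and in `cutMatrix` too, since the matrices agree there. The minor on `T` thus reduces to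
proper subsets. Only density of `A` enters. -/

section

open Matrix

/-- The principal minor of `A` on the index set `S`. -/
def pminor {V R : Type*} [DecidableEq V] [CommRing R] (A : Matrix V V R) (S : Finset V) : R :=
  (principal A S).det

/-- `A[K, L]` has rank at most one, in the form of vanishing `2 × 2` minors. -/
def RankOneAcross {V R : Type*} [CommRing R] (A : Matrix V V R) (K L : Finset V) : Prop :=
  ∀ x ∈ K, ∀ p ∈ K, ∀ y ∈ L, ∀ q ∈ L, A x y * A p q = A x q * A p y

lemma RankOneAcross.of_eq_mul {V R : Type*} [CommRing R] {A : Matrix V V R} {K L : Finset V}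
    (u v : V → R) (h : ∀ x ∈ K, ∀ y ∈ L, A x y = u x * v y) : RankOneAcross A K L := by
  intro x hx p hp y hy q hq
  rw [h x hx y hy, h p hp q hq, h x hx q hq, h p hp y hy]
  ring

/-! ### Principal minors across a cut -/

section Minors

variable {V : Type*} [DecidableEq V]

lemma pminor_eq_det_submatrix {R ι : Type*} [CommRing R] [Fintype ι] [DecidableEq ι]
    (A : Matrix V V R) (f : ι → V) (hf : Function.Injective f) {S : Finset V}
    (hS : ∀ v, v ∈ S ↔ ∃ i, f i = v) : pminor A S = (A.submatrix f f).det := by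
  let e : ι ≃ S := Equiv.ofBijective (fun i => ⟨f i, (hS _).2 ⟨i, rfl⟩⟩)
    ⟨fun i j h => hf (by simpa using h), fun ⟨v, hv⟩ => by
      obtain ⟨i, hi⟩ := (hS v).1 hv
      exact ⟨i, Subtype.ext hi⟩⟩
  have h : A.submatrix f f = (principal A S).submatrix e e := rfl
  rw [h, det_submatrix_equiv_self, pminor]

lemma pminor_congr {R : Type*} [CommRing R] {A B : Matrix V V R} {S : Finset V}
    (h : ∀ i ∈ S, ∀ j ∈ S, A i j = B i j) : pminor A S = pminor B S := by
  unfold pminor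
  congr 1
  ext i j
  exact h i i.2 j j.2

lemma pminor_map {R R' : Type*} [CommRing R] [CommRing R'] (φ : R →+* R')
    (A : Matrix V V R) (S : Finset V) : pminor (A.map φ) S = φ (pminor A S) := by
  unfold pminor
  rw [RingHom.map_det]
  rfl

lemma pminor_smul_congr {F : Type*} [Field F] {A B : Matrix V V F} {S : Finset V} (d : V → F)
    (hd : ∀ i ∈ S, d i ≠ 0)
    (h : ∀ i ∈ S, ∀ j ∈ S, A i j * d j = d i * B i j) : pminor A S = pminor B S := by
  have h1 : principal A S * diagonal (fun i : S => d i) =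
      diagonal (fun i : S => d i) * principal B S := by
    ext i j
    simpa [mul_diagonal, diagonal_mul, principal, block] using h i i.2 j j.2
  have h2 := congrArg det h1
  rw [det_mul, det_mul, mul_comm] at h2
  refine mul_left_cancel₀ ?_ h2
  rw [det_diagonal]
  exact Finset.prod_ne_zero_iff.2 fun i _ => hd i i.2

lemma pminor_singleton {R : Type*} [CommRing R] (A : Matrix V V R) (i : V) :
    pminor A {i} = A i i := by
  rw [pminor_eq_det_submatrix A (fun _ : Fin 1 => i) (fun _ _ _ => Subsingleton.elim _ _)
    (by simp [eq_comm])]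
  simp

lemma pminor_pair {R : Type*} [CommRing R] (A : Matrix V V R) {i j : V} (hij : i ≠ j) :
    pminor A {i, j} = A i i * A j j - A i j * A j i := by
  rw [pminor_eq_det_submatrix A ![i, j]
    (by intro a b; fin_cases a <;> fin_cases b <;> simp [hij, hij.symm])
    (by simp [Fin.exists_fin_two, eq_comm]), det_fin_two]
  rfl

lemma pminor_triple {R : Type*} [CommRing R] (A : Matrix V V R) {i j k : V} (hij : i ≠ j)
    (hik : i ≠ k) (hjk : j ≠ k) :
    pminor A {i, j, k} = A i i * A j j * A k k - A i i * A j k * A k j - A i j * A j i * A k k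
      + A i j * A j k * A k i + A i k * A j i * A k j - A i k * A j j * A k i := by
  rw [pminor_eq_det_submatrix A ![i, j, k]
    (by intro a b; fin_cases a <;> fin_cases b <;>
      simp [hij, hij.symm, hik, hik.symm, hjk, hjk.symm])
    (by simp [Fin.exists_fin_succ, eq_comm]), det_fin_three]
  rfl

lemma pminor_insert_of_isUnit {F : Type*} [Field F] (M : Matrix V V F) {S : Finset V} {q : V}
    (hq : q ∉ S) (hS : pminor M S ≠ 0) :
    pminor M (insert q S) = pminor M S *
      (M q q - (fun s : S => M q s) ⬝ᵥ ((principal M S)⁻¹ *ᵥ fun s : S => M s q)) := by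
  have hu : IsUnit (principal M S) := (isUnit_iff_isUnit_det _).2 (isUnit_iff_ne_zero.2 hS)
  have := hu.invertible
  rw [pminor_eq_det_submatrix M (Sum.elim (fun s : S => (s : V)) (fun _ : Unit => q))]
  · have : M.submatrix (Sum.elim (fun s : S => (s : V)) (fun _ : Unit => q))
        (Sum.elim (fun s : S => (s : V)) (fun _ : Unit => q)) =
        fromBlocks (principal M S) (replicateCol Unit fun s : S => M s q)
          (replicateRow Unit fun s : S => M q s) (of fun _ _ => M q q) := by
      ext (i | i) (j | j) <;> rfl
    rw [this, det_fromBlocks₁₁, invOf_eq_nonsing_inv, Matrix.mul_assoc, det_unique (n := Unit)]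
    rfl
  · rintro (a | a) (b | b) h
    · exact congrArg _ (Subtype.ext h)
    · exact absurd ((show (a : V) = q from h) ▸ a.2) hq
    · exact absurd ((show q = (b : V) from h).symm ▸ b.2) hq
    · rfl
  · intro v
    simp only [Finset.mem_insert, Sum.exists, Sum.elim_inl, Sum.elim_inr, Subtype.exists,
      exists_prop, exists_eq_right, exists_const]
    tauto

lemma det_sub_smul_rankOne {F ι : Type*} [Field F] [Fintype ι] [DecidableEq ι]
    {Q : Matrix ι ι F} (hQ : Q.det ≠ 0) (σ : F) (w v : ι → F) :
    (Q - σ • vecMulVec w v).det = Q.det * (1 - σ * (v ⬝ᵥ (Q⁻¹ *ᵥ w))) := by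
  have h : Q - σ • vecMulVec w v = Q + replicateCol Unit (-(σ • w)) * replicateRow Unit v := by
    rw [← vecMulVec_eq, sub_eq_add_neg]
    congr 1
    ext i j
    simp [vecMulVec, mul_assoc]
  rw [h, det_add_replicateCol_mul_replicateRow (isUnit_iff_ne_zero.2 hQ),
    Matrix.mul_assoc, det_unique (n := Unit)]
  congr 1
  have : (replicateRow Unit v * (Q⁻¹ * replicateCol Unit (-(σ • w)))) default default =
      v ⬝ᵥ (Q⁻¹ *ᵥ (-(σ • w))) := rfl
  rw [Matrix.add_apply, this, mulVec_neg, mulVec_smul, dotProduct_neg, dotProduct_smul]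
  simp [sub_eq_add_neg]

/-- The formula of `pminor_cut` when the two principal blocks are invertible. -/
lemma pminor_cut_of_ne_zero {F : Type*} [Field F] (M : Matrix V V F) {K L : Finset V}
    (hKL : Disjoint K L) (hK : RankOneAcross M K L) (hK' : RankOneAcross Mᵀ K L) {p q : V}
    (hp : p ∈ K) (hq : q ∈ L)
    (hpq : M p q ≠ 0) (hqp : M q p ≠ 0)
    {S₁ S₂ : Finset V} (hS₁ : S₁ ⊆ K) (hS₂ : S₂ ⊆ L) (h1 : pminor M S₁ ≠ 0) (h2 : pminor M S₂ ≠ 0) :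
    M p q * M q p * (pminor M (S₁ ∪ S₂) - pminor M S₁ * pminor M S₂) =
      -((M q q * pminor M S₁ - pminor M (insert q S₁)) *
        (M p p * pminor M S₂ - pminor M (insert p S₂))) := by
  have hd : ∀ x ∈ K, ∀ y ∈ L, x ≠ y := fun x hx y hy e =>
    Finset.disjoint_left.1 hKL hx (e ▸ hy)
  rw [pminor_insert_of_isUnit M (fun h => hd q (hS₁ h) q hq rfl) h1,
    pminor_insert_of_isUnit M (fun h => hd p hp p (hS₂ h) rfl) h2]
  have hu : IsUnit (principal M S₁) := (isUnit_iff_isUnit_det _).2 (isUnit_iff_ne_zero.2 h1)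
  have := hu.invertible
  set u : S₁ → F := fun s => M s q with hu
  set z : S₁ → F := fun s => M q s with hz
  set w : S₂ → F := fun s => M s p / M q p with hw
  set v : S₂ → F := fun s => M p s / M p q with hv
  have hm1 : ∀ s : S₁, (s : V) ∈ K := fun s => hS₁ s.2
  have hm2 : ∀ s : S₂, (s : V) ∈ L := fun s => hS₂ s.2
  have hT : pminor M (S₁ ∪ S₂) = pminor M S₁ * (pminor M S₂ *
      (1 - (z ⬝ᵥ ((principal M S₁)⁻¹ *ᵥ u)) * (v ⬝ᵥ ((principal M S₂)⁻¹ *ᵥ w)))) := by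
    rw [pminor_eq_det_submatrix M (Sum.elim (fun s : S₁ => (s : V)) (fun s : S₂ => (s : V)))]
    · have : M.submatrix (Sum.elim (fun s : S₁ => (s : V)) (fun s : S₂ => (s : V)))
          (Sum.elim (fun s : S₁ => (s : V)) (fun s : S₂ => (s : V))) =
          fromBlocks (principal M S₁) (vecMulVec u v) (vecMulVec w z) (principal M S₂) := by
        ext (i | i) (j | j)
        · rfl
        · have := hK i (hm1 i) p hp j (hm2 j) q hq
          simp only [submatrix_apply, Sum.elim_inl, Sum.elim_inr, fromBlocks_apply₁₂,
            vecMulVec_apply, hu, hv]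
          field_simp
          exact this
        · have := hK' j (hm1 j) p hp i (hm2 i) q hq
          simp only [transpose_apply] at this
          simp only [submatrix_apply, Sum.elim_inl, Sum.elim_inr, fromBlocks_apply₂₁,
            vecMulVec_apply, hw, hz]
          field_simp
          linear_combination this
        · rfl
      rw [this, det_fromBlocks₁₁, invOf_eq_nonsing_inv, vecMulVec_mul, vecMulVec_mul_vecMulVec]
      have e : vecMulVec w ((z ᵥ* (principal M S₁)⁻¹ ⬝ᵥ u) • v) =
          (z ⬝ᵥ ((principal M S₁)⁻¹ *ᵥ u)) • vecMulVec w v := by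
        rw [← dotProduct_mulVec]
        ext i j
        simp [vecMulVec_apply, mul_left_comm]
      rw [e, det_sub_smul_rankOne h2]
      rfl
    · rintro (a | a) (b | b) h
      · exact congrArg _ (Subtype.ext h)
      · exact absurd h (hd _ (hm1 a) _ (hm2 b))
      · exact absurd h.symm (hd _ (hm1 b) _ (hm2 a))
      · exact congrArg _ (Subtype.ext h)
    · intro x
      simp only [Sum.exists, Sum.elim_inl, Sum.elim_inr, Subtype.exists, exists_prop,
        exists_eq_right, Finset.mem_union]
  have hw' : (fun s : S₂ => M s p) = M q p • w := by
    ext s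
    simp only [hw, Pi.smul_apply, smul_eq_mul]
    field_simp
  have hv' : (fun s : S₂ => M p s) = M p q • v := by
    ext s
    simp only [hv, Pi.smul_apply, smul_eq_mul]
    field_simp
  rw [hT, hw', hv', mulVec_smul, dotProduct_smul, smul_dotProduct]
  simp only [smul_eq_mul]
  ring

/-- If `M[K, L]` and `M[L, K]` have rank at most one, then every principal minor on `K ∪ L` is
determined by principal minors that lie, up to one index, in `K` or in `L`. -/
lemma pminor_cut [Fintype V] {F : Type*} [Field F] (M : Matrix V V F) {K L : Finset V}
    (hKL : Disjoint K L) (hK : RankOneAcross M K L) (hK' : RankOneAcross Mᵀ K L) {p q : V}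
    (hp : p ∈ K) (hq : q ∈ L)
    (hpq : M p q ≠ 0) (hqp : M q p ≠ 0)
    {S₁ S₂ : Finset V} (hS₁ : S₁ ⊆ K) (hS₂ : S₂ ⊆ L) :
    M p q * M q p * (pminor M (S₁ ∪ S₂) - pminor M S₁ * pminor M S₂) =
      -((M q q * pminor M S₁ - pminor M (insert q S₁)) *
        (M p p * pminor M S₂ - pminor M (insert p S₂))) := by
  have hd : ∀ x ∈ K, ∀ y ∈ L, x ≠ y := fun x hx y hy e =>
    Finset.disjoint_left.1 hKL hx (e ▸ hy)
  -- `N` is `X • 1 + M`. Its principal minors are monic polynomials, hence invertible in the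
  -- fraction field, and its off-diagonal entries are those of `M`. The identity holds for `N` there
  -- and is specialised at `X = 0`.
  set N := charmatrix (-M) with hN
  set φ := algebraMap (Polynomial F) (FractionRing (Polynomial F)) with hφ
  have hinj : Function.Injective φ := IsFractionRing.injective _ _
  have hne : ∀ x y, x ≠ y → N x y = Polynomial.C (M x y) := fun x y h => by
    simp [hN, charmatrix_apply_ne _ _ _ h]
  have hminor : ∀ S, pminor N S = (-(principal M S)).charpoly := fun S => by
    unfold pminor Matrix.charpoly
    congr 1
    ext1 i j
    rcases eq_or_ne i j with rfl | h
    · simp [principal, block, hN]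
    · rw [charmatrix_apply_ne _ _ _ h]
      simp only [principal, block, submatrix_apply]
      rw [hne _ _ (fun e => h (Subtype.ext e))]
      simp
  have hev : N.map (Polynomial.evalRingHom (0 : F)) = M := by
    ext x y
    rcases eq_or_ne x y with rfl | h
    · simp [hN]
    · simp [hne x y h]
  have key := pminor_cut_of_ne_zero (N.map φ) hKL ?_ ?_ hp hq ?_ ?_ hS₁ hS₂ ?_ ?_
  · simp only [pminor_map, map_apply] at key
    have key' : N p q * N q p * (pminor N (S₁ ∪ S₂) - pminor N S₁ * pminor N S₂) =
      -((N q q * pminor N S₁ - pminor N (insert q S₁)) *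
        (N p p * pminor N S₂ - pminor N (insert p S₂))) := by
      apply hinj
      simpa only [map_mul, map_sub, map_neg] using key
    have := congrArg (Polynomial.evalRingHom (0 : F)) key'
    simp only [map_mul, map_sub, map_neg, ← pminor_map, hev] at this
    have he : ∀ x y, Polynomial.evalRingHom (0 : F) (N x y) = M x y := fun x y =>
      congrFun (congrFun hev x) y
    simpa only [he] using this
  · intro x hx p hp y hy q hq
    simp only [map_apply, hne _ _ (hd x hx y hy), hne _ _ (hd p hp q hq), hne _ _ (hd x hx q hq),
      hne _ _ (hd p hp y hy), ← map_mul, hK x hx p hp y hy q hq]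
  · intro x hx p hp y hy q hq
    have h : ∀ x ∈ K, ∀ y ∈ L, y ≠ x := fun x hx y hy => (hd x hx y hy).symm
    have := hK' x hx p hp y hy q hq
    simp only [transpose_apply] at this
    simp only [transpose_apply, map_apply, hne _ _ (h x hx y hy), hne _ _ (h p hp q hq),
      hne _ _ (h x hx q hq), hne _ _ (h p hp y hy), ← map_mul, this]
  · rw [map_apply, hne _ _ (hd p hp q hq)]
    exact (map_ne_zero_iff φ hinj).2 (Polynomial.C_ne_zero.2 hpq)
  · rw [map_apply, hne _ _ (hd p hp q hq).symm]
    exact (map_ne_zero_iff φ hinj).2 (Polynomial.C_ne_zero.2 hqp)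
  all_goals
    rw [pminor_map, hminor]
    exact (map_ne_zero_iff φ hinj).2 (charpoly_monic _).ne_zero

/-- Since `M p q * M q p ≠ 0`, the identity `pminor_cut` can be solved for the minor on `S₁ ∪ S₂`;
every other quantity in it is the same for `M` and `N`. -/
lemma pminor_union_eq [Fintype V] {F : Type*} [Field F] {M N : Matrix V V F} {K L : Finset V}
    (hKL : Disjoint K L) (hM : RankOneAcross M K L) (hM' : RankOneAcross Mᵀ K L)
    (hN : RankOneAcross N K L) (hN' : RankOneAcross Nᵀ K L) {p q : V}
    (hp : p ∈ K) (hq : q ∈ L) (hpq : M p q ≠ 0) (hqp : M q p ≠ 0)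
    (hpp : M p p = N p p) (hqq : M q q = N q q) (hMN : M p q * M q p = N p q * N q p)
    {S₁ S₂ : Finset V} (hS₁ : S₁ ⊆ K) (hS₂ : S₂ ⊆ L)
    (h₁ : pminor M S₁ = pminor N S₁) (h₂ : pminor M S₂ = pminor N S₂)
    (h₁' : pminor M (insert q S₁) = pminor N (insert q S₁))
    (h₂' : pminor M (insert p S₂) = pminor N (insert p S₂)) :
    pminor M (S₁ ∪ S₂) = pminor N (S₁ ∪ S₂) := by
  have hN0 : N p q * N q p ≠ 0 := hMN ▸ mul_ne_zero hpq hqp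
  have e1 := pminor_cut M hKL hM hM' hp hq hpq hqp hS₁ hS₂
  have e2 := pminor_cut N hKL hN hN' hp hq (left_ne_zero_of_mul hN0) (right_ne_zero_of_mul hN0)
    hS₁ hS₂
  rw [h₁, h₂, h₁', h₂', hpp, hqq, ← e2, hMN] at e1
  linear_combination mul_left_cancel₀ hN0 e1

end Minors

/-! ### Four indices: what property `P` leaves to a dense matrix -/

/-- `{i, j}` against `{k, l}` is a cut of `A[{i, j, k, l}]`. -/
def SplitsPairs {V F : Type*} [Field F] (A : Matrix V V F) (i j k l : V) : Prop :=
  A i k * A j l = A i l * A j k ∧ A k i * A l j = A k j * A l i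

/-- Both other partitions of `{i, j, k, l}` into pairs are cuts of `A[{i, j, k, l}]`. -/
def SplitsCross {V F : Type*} [Field F] (A : Matrix V V F) (i j k l : V) : Prop :=
  SplitsPairs A i k j l ∧ SplitsPairs A i l j k

lemma SplitsPairs.symm {V F : Type*} [Field F] {A : Matrix V V F} {i j k l : V}
    (h : SplitsPairs A i j k l) : SplitsPairs A k l i j :=
  ⟨h.2, h.1⟩

lemma SplitsPairs.swap {V F : Type*} [Field F] {A : Matrix V V F} {i j k l : V}
    (h : SplitsPairs A i j k l) : SplitsPairs A j i l k :=
  ⟨by linear_combination h.1, by linear_combination h.2⟩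

lemma splitsPairs_transpose {V F : Type*} [Field F] (A : Matrix V V F) (i j k l : V) :
    SplitsPairs Aᵀ i j k l ↔ SplitsPairs A i j k l := by
  simp only [SplitsPairs, transpose_apply]
  rw [and_comm, mul_comm (A j k)]
  exact and_congr_right fun _ => by rw [mul_comm (A l i)]

section Quartets

variable {V F : Type*} [DecidableEq V] [Field F]

lemma mul_eq_mul_of_rank_le_one {m n : Type*} [Fintype n] {M : Matrix m n F} (h : M.rank ≤ 1)
    (x p : m) (y q : n) : M x y * M p q = M x q * M p y := by
  have h1 : (M.submatrix ![x, p] ![y, q]).rank ≤ 1 := (rank_submatrix_le _ _ _).trans h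
  have h2 : (M.submatrix ![x, p] ![y, q]).det = 0 := by
    by_contra hne
    rw [rank_of_isUnit _ ((isUnit_iff_isUnit_det _).2 (isUnit_iff_ne_zero.2 hne))] at h1
    simp at h1
  rw [det_fin_two] at h2
  simpa [sub_eq_zero] using h2

lemma IsCut.rankOneAcross [Fintype V] {A : Matrix V V F} {K : Finset V} (h : IsCut A K) :
    RankOneAcross A K Kᶜ ∧ RankOneAcross Aᵀ K Kᶜ := by
  refine ⟨fun x hx p hp y hy q hq => ?_, fun x hx p hp y hy q hq => ?_⟩
  · exact mul_eq_mul_of_rank_le_one h.2.2.1 ⟨x, hx⟩ ⟨p, hp⟩ ⟨y, hy⟩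
      ⟨q, hq⟩
  · have := mul_eq_mul_of_rank_le_one h.2.2.2 ⟨y, hy⟩ ⟨q, hq⟩
      ⟨x, hx⟩ ⟨p, hp⟩
    simp only [block, submatrix_apply] at this
    simp only [transpose_apply]
    linear_combination this

lemma det_fin_four {R : Type*} [CommRing R] (A : Matrix (Fin 4) (Fin 4) R) :
    A.det = A 0 0 * (A 1 1 * A 2 2 * A 3 3 - A 1 1 * A 2 3 * A 3 2 - A 1 2 * A 2 1 * A 3 3
      + A 1 2 * A 2 3 * A 3 1 + A 1 3 * A 2 1 * A 3 2 - A 1 3 * A 2 2 * A 3 1)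
    - A 0 1 * (A 1 0 * A 2 2 * A 3 3 - A 1 0 * A 2 3 * A 3 2 - A 1 2 * A 2 0 * A 3 3
      + A 1 2 * A 2 3 * A 3 0 + A 1 3 * A 2 0 * A 3 2 - A 1 3 * A 2 2 * A 3 0)
    + A 0 2 * (A 1 0 * A 2 1 * A 3 3 - A 1 0 * A 2 3 * A 3 1 - A 1 1 * A 2 0 * A 3 3
      + A 1 1 * A 2 3 * A 3 0 + A 1 3 * A 2 0 * A 3 1 - A 1 3 * A 2 1 * A 3 0)
    - A 0 3 * (A 1 0 * A 2 1 * A 3 2 - A 1 0 * A 2 2 * A 3 1 - A 1 1 * A 2 0 * A 3 2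
      + A 1 1 * A 2 2 * A 3 0 + A 1 2 * A 2 0 * A 3 1 - A 1 2 * A 2 1 * A 3 0) := by
  rw [det_succ_row_zero]
  simp only [Fin.sum_univ_four, det_fin_three, submatrix_apply]
  simp [Fin.succAbove, Fin.lt_def]
  ring

lemma pminor_quadruple {R : Type*} [CommRing R] (A : Matrix V V R) {i j k l : V} (hij : i ≠ j)
    (hik : i ≠ k) (hil : i ≠ l) (hjk : j ≠ k) (hjl : j ≠ l) (hkl : k ≠ l) :
    pminor A {i, j, k, l} = (A.submatrix ![i, j, k, l] ![i, j, k, l]).det := by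
  refine pminor_eq_det_submatrix A ![i, j, k, l] ?_ (by simp [Fin.exists_fin_succ, eq_comm])
  intro a b
  fin_cases a <;> fin_cases b <;>
      simp [hij, hij.symm, hik, hik.symm, hjk, hjk.symm, hil, hil.symm, hjl, hjl.symm, hkl,
        hkl.symm]

/-- The algebraic core of `splitsPairs_or_splitsCross`: the variables are the off-diagonal entries
of a `4 × 4` matrix. -/
lemma quartet_dichotomy {ij ji ik ki il li jk kj jl lj kl lk Φ Θ Ω : F}
    (hij : ij ≠ 0) (hji : ji ≠ 0) (hik : ik ≠ 0) (hki : ki ≠ 0) (hil : il ≠ 0) (hli : li ≠ 0)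
    (hjk : jk ≠ 0) (hkj : kj ≠ 0) (hjl : jl ≠ 0) (hlj : lj ≠ 0) (hkl : kl ≠ 0) (hlk : lk ≠ 0)
    (p1 : jk * kj = Φ * (ik * ki)) (p2 : jl * lj = Φ * (il * li))
    (t1 : ij * jk * ki + ik * ji * kj = ik * ki * Θ)
    (t2 : ij * jl * li + il * ji * lj = il * li * Θ)
    (t3 : ik * kl * li + il * ki * lk = Ω)
    (t4 : jk * kl * lj + jl * kj * lk = Φ * Ω)
    (q : ij * jk * kl * li + ij * jl * lk * ki + ik * kj * jl * li + ik * kl * lj * ji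
      + il * lj * jk * ki + il * lk * kj * ji - ik * ki * (jl * lj) - il * li * (jk * kj)
      = Θ * Ω) :
    (ik * jl = il * jk ∧ ki * lj = kj * li) ∨
      ((ij * kl = il * kj ∧ ji * lk = jk * li) ∧ (ij * lk = ik * lj ∧ ji * kl = jl * ki)) := by
  have hΦ : Φ ≠ 0 := by
    rintro rfl
    simp [hjk, hkj] at p1
  by_cases hT : ik * jl = il * jk
  · refine Or.inl ⟨hT, ?_⟩
    have h : (ik * jl) * (ki * lj) = (ik * jl) * (kj * li) := by
      rw [show (ik * jl) * (kj * li) = il * jk * (kj * li) by rw [hT]]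
      linear_combination ik * ki * p2 - il * li * p1
    exact mul_left_cancel₀ (mul_ne_zero hik hjl) h
  · right
    -- Two pairs with equal sum and equal product coincide up to order. The failure of `hT` excludes
    -- the identical order, so the pairs below are exchanged.
    have swap : ∀ x y x' y' : F, x ≠ x' → x + y = x' + y' → x * y = x' * y' → x = y' ∧ y = x' := by
      intro x y x' y' hne hs hm
      have : (x - x') * (x - y') = 0 := by linear_combination x * hs - hm
      have h1 : x = y' :=
        sub_eq_zero.1 ((mul_eq_zero.1 this).resolve_left (sub_ne_zero.2 hne))
      exact ⟨h1, by linear_combination hs - h1⟩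
    obtain ⟨e1, e2⟩ : ik * ji / jk = ij * li / lj ∧ ij * ki / kj = il * ji / jl := by
      refine swap _ _ _ _ ?_ (Eq.trans (b := Θ / Φ) ?_ ?_) (Eq.trans (b := ij * ji / Φ) ?_ ?_)
      · intro h
        field_simp at h
        exact hT (by linear_combination h)
      · field_simp
        linear_combination Φ * t1 - Θ * p1
      · field_simp
        linear_combination Θ * p2 - Φ * t2
      · field_simp
        linear_combination -p1
      · field_simp
        linear_combination p2
    obtain ⟨e3, -⟩ : ki * lk / li = kl * jk / jl ∧ kl * ik / il = kj * lk / lj := by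
      refine swap _ _ _ _ ?_ (Eq.trans (b := Ω / (il * li)) ?_ ?_)
        (Eq.trans (b := kl * lk * (ik * ki) / (il * li)) ?_ ?_)
      · intro h
        field_simp at h
        have h' : (ki * ik) * (lj * jl) = (kj * jk) * (li * il) := by
          linear_combination ki * ik * p2 - li * il * p1
        apply hT
        apply mul_left_cancel₀ (mul_ne_zero hki hlj)
        linear_combination h' - il * jk * h
      · field_simp
        linear_combination t3
      · field_simp
        linear_combination Ω * p2 - il * li * t4
      · field_simp
      · field_simp
        linear_combination ik * ki * p2 - il * li * p1
    field_simp at e1 e2 e3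
    have hlj' : lj = jk * ij * li / (ik * ji) := by field_simp; linear_combination e1
    have hkj' : kj = jl * ij * ki / (il * ji) := by field_simp; linear_combination -e2
    have hlk' : lk = li * kl * jk / (ki * jl) := by field_simp; linear_combination e3
    have hq : ik * ki * (ij * jk * kl * li + ij * jl * lk * ki + ik * kj * jl * li
      + ik * kl * lj * ji
      + il * lj * jk * ki + il * lk * kj * ji - ik * ki * (jl * lj) - il * li * (jk * kj))
      = (ij * jk * ki + ik * ji * kj) * (ik * kl * li + il * ki * lk) := by
      rw [q, t1, t3]; ring
    -- The exchanged pairs express `lj`, `kj`, `lk` by the other entries; the four-cycle condition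
    -- then becomes `(ik * jl - il * jk) ^ 2 * (ji * kl - jl * ki) = 0`.
    have key : ji * kl = jl * ki := by
      subst hlj' hkj' hlk'
      field_simp at hq
      have h : (ik * jl - il * jk) ^ 2 * (ji * kl - jl * ki) = 0 := by linear_combination -hq
      exact sub_eq_zero.1 ((mul_eq_zero.1 h).resolve_left (pow_ne_zero 2 (sub_ne_zero.2 hT)))
    subst hlj' hkj' hlk'
    refine ⟨⟨?_, ?_⟩, ?_, key⟩
    · field_simp
      linear_combination key
    · field_simp
      linear_combination key
    · field_simp
      linear_combination key

/-- The cut makes row `j` of `C` a multiple `a` of row `i` in columns `k`, `l`, and column `j` a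
multiple `b` of column `i` in rows `k`, `l`. With `Φ = a * b`, `Θ = C i j * a + C j i * b` and `Ω`
the sum of the two three-cycles on `i, k, l`, the cycle sums of `C` factor; being determined by
principal minors, they are those of `A`. -/
lemma SplitsPairs.or_splitsCross_of_pminor_eq {A C : Matrix V V F} (hA : IsDense A)
    (h : ∀ S, pminor C S = pminor A S) {i j k l : V} (hij : i ≠ j)
    (hik : i ≠ k) (hil : i ≠ l) (hjk : j ≠ k) (hjl : j ≠ l) (hkl : k ≠ l)
    (hC : SplitsPairs C i j k l) : SplitsPairs A i j k l ∨ SplitsCross A i j k l := by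
  have hd : ∀ x, C x x = A x x := fun x => by
    simpa only [pminor_singleton] using h {x}
  have h2 : ∀ {x y}, x ≠ y → C x y * C y x = A x y * A y x := fun {x y} hxy => by
    have := h {x, y}
    rw [pminor_pair _ hxy, pminor_pair _ hxy, hd, hd] at this
    linear_combination -this
  have h3 : ∀ {x y z}, x ≠ y → x ≠ z → y ≠ z →
      C x y * C y z * C z x + C x z * C y x * C z y =
        A x y * A y z * A z x + A x z * A y x * A z y := fun {x y z} hxy hxz hyz => by
    have := h {x, y, z}
    rw [pminor_triple _ hxy hxz hyz, pminor_triple _ hxy hxz hyz, hd, hd, hd] at this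
    linear_combination this + A x x * h2 hyz + A z z * h2 hxy + A y y * h2 hxz
  have hCd : IsDense C := fun x y hxy h0 => by
    have := h2 hxy
    rw [h0, zero_mul] at this
    exact mul_ne_zero (hA x y hxy) (hA y x hxy.symm) this.symm
  obtain ⟨hC1, hC2⟩ := hC
  have nik := hCd i k hik
  have nki := hCd k i hik.symm
  have ejl : C j l = C j k / C i k * C i l := by field_simp; linear_combination hC1
  have elj : C l j = C k j / C k i * C l i := by field_simp; linear_combination hC2
  refine quartet_dichotomy (Φ := C j k / C i k * (C k j / C k i))
    (Θ := C i j * (C j k / C i k) + C j i * (C k j / C k i))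
    (Ω := C i k * C k l * C l i + C i l * C k i * C l k)
    (hA i j hij) (hA j i hij.symm) (hA i k hik) (hA k i hik.symm) (hA i l hil) (hA l i hil.symm)
    (hA j k hjk) (hA k j hjk.symm) (hA j l hjl) (hA l j hjl.symm) (hA k l hkl) (hA l k hkl.symm)
    ?_ ?_ ?_ ?_ ?_ ?_ ?_
  · rw [← h2 hjk, ← h2 hik]
    field_simp
  · rw [← h2 hjl, ← h2 hil, ejl, elj]
    field_simp
  · rw [← h3 hij hik hjk, ← h2 hik]
    field_simp
  · rw [← h3 hij hil hjl, ← h2 hil, ejl, elj]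
    field_simp
  · rw [← h3 hik hil hkl]
  · rw [← h3 hjk hjl hkl, ejl, elj]
    field_simp
  · have h4 := h {i, j, k, l}
    rw [pminor_quadruple _ hij hik hil hjk hjl hkl, pminor_quadruple _ hij hik hil hjk hjl hkl,
      det_fin_four, det_fin_four] at h4
    simp only [submatrix_apply, cons_val, hd] at h4
    -- The four-cycles minus two of the three products of disjoint two-cycles: the third product,
    -- `ij` with `kl`, is already controlled by the `2 × 2` minors.
    have hc : C i j * C j k * C k l * C l i + C i j * C j l * C l k * C k i
        + C i k * C k j * C j l * C l i + C i k * C k l * C l j * C j i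
        + C i l * C l j * C j k * C k i + C i l * C l k * C k j * C j i
        - C i k * C k i * (C j l * C l j) - C i l * C l i * (C j k * C k j) =
        (C i j * (C j k / C i k) + C j i * (C k j / C k i)) *
          (C i k * C k l * C l i + C i l * C k i * C l k) := by
      rw [ejl, elj]
      field_simp
      ring
    rw [← hc]
    linear_combination h4 + A i i * A j j * h2 hkl + A i i * A k k * h2 hjl
      + A i i * A l l * h2 hjk + A j j * A k k * h2 hil + A j j * A l l * h2 hik
      + A k k * A l l * h2 hij - A i i * h3 hjk hjl hkl - A j j * h3 hik hil hkl
      - A k k * h3 hij hil hjl - A l l * h3 hij hik hjk - C i j * C j i * h2 hkl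
      - A k l * A l k * h2 hij

lemma PropertyP.splitsPairs_or_splitsCross {A : Matrix V V F} (hA : IsDense A) {i j k l : V}
    (hij : i ≠ j) (hik : i ≠ k) (hil : i ≠ l) (hjk : j ≠ k) (hjl : j ≠ l) (hkl : k ≠ l)
    (h : PropertyP A i j k l) : SplitsPairs A i j k l ∨ SplitsCross A i j k l := by
  unfold PropertyP at h
  set T : Finset V := {i, j, k, l} with hT
  obtain ⟨C, hPME, hcut⟩ := h
  obtain ⟨h1, h2⟩ := hcut.rankOneAcross
  let i' : T := ⟨i, by simp [hT]⟩
  let j' : T := ⟨j, by simp [hT]⟩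
  let k' : T := ⟨k, by simp [hT]⟩
  let l' : T := ⟨l, by simp [hT]⟩
  have ne : ∀ {x y : T}, (x : V) ≠ y → x ≠ y := fun h e => h (congrArg _ e)
  have hi : i' ∈ ({i, j} : Finset V).subtype (fun v => v ∈ T) := by simp [i']
  have hj : j' ∈ ({i, j} : Finset V).subtype (fun v => v ∈ T) := by simp [j']
  have hk : k' ∈ (({i, j} : Finset V).subtype (fun v => v ∈ T))ᶜ := by
    simp [k', hik.symm, hjk.symm]
  have hl : l' ∈ (({i, j} : Finset V).subtype (fun v => v ∈ T))ᶜ := by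
    simp [l', hil.symm, hjl.symm]
  exact SplitsPairs.or_splitsCross_of_pminor_eq (A := principal A T) (C := C) (i := i') (j := j')
    (k := k') (l := l') (fun x y hxy => hA x y fun e => hxy (Subtype.ext e)) hPME (ne hij) (ne hik)
    (ne hil) (ne hjk) (ne hjl) (ne hkl)
    ⟨h1 i' hi j' hj k' hk l' hl, by
      have := h2 i' hi j' hj k' hk l' hl
      simp only [transpose_apply] at this
      linear_combination this⟩

end Quartets

/-! ### Independence of the cut matrix from its base points -/

section BaseChange

variable {V F : Type*} [DecidableEq V] [Field F]

/-- Rescaling the entries between `i` and `Q` exchanges the two three-cycle products on `i, k, l`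
for `k ∈ P`, `l ∈ Q`, so the `3 × 3` minors survive. Larger minors follow by induction from the cuts
`P | Q ∪ {i}` and `Q | P ∪ {i}`, which both matrices have. -/
lemma pminor_insert_union_eq_of_rescale [Fintype V] {M N : Matrix V V F} (hM : IsDense M) {i : V}
    {P Q : Finset V} (hiP : i ∉ P) (hiQ : i ∉ Q) (hPQ : Disjoint P Q) {α β : F} (hα : α ≠ 0)
    (hβ : β ≠ 0)
    (hr : ∀ k ∈ P, ∀ l ∈ Q, M k l = α * (M k i * M i l) ∧ M l k = β * (M l i * M i k))
    (hN : ∀ x ∈ P ∪ Q, ∀ y ∈ P ∪ Q, N x y = M x y) (hNi : N i i = M i i)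
    (hNP : ∀ k ∈ P, N i k = M i k ∧ N k i = M k i)
    (hNQ : ∀ l ∈ Q, N i l = α / β * M i l ∧ N l i = β / α * M l i)
    (S T : Finset V) (hS : S ⊆ P) (hT : T ⊆ Q) :
    pminor M (insert i (S ∪ T)) = pminor N (insert i (S ∪ T)) := by
  have hP : ∀ {x}, x ∈ P → x ∈ P ∪ Q := fun h => Finset.mem_union_left _ h
  have hQ : ∀ {x}, x ∈ Q → x ∈ P ∪ Q := fun h => Finset.mem_union_right _ h
  have hdis : ∀ {x}, x ∈ P → x ∉ Q := fun h h' => Finset.disjoint_left.1 hPQ h h'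
  induction hn : S.card + T.card using Nat.strong_induction_on generalizing S T with
  | _ n ih =>
  rcases S.eq_empty_or_nonempty with rfl | hS0
  -- With `P` absent, the rescaling is a diagonal conjugation.
  · refine pminor_smul_congr (fun x => if x = i then 1 else α / β) ?_ ?_
    · intro x _
      by_cases h : x = i <;> simp [h, hα, hβ]
    · intro x hx y hy
      simp only [Finset.empty_union, Finset.mem_insert] at hx hy
      have hne : ∀ {z}, z ∈ T → z ≠ i := fun hz e => hiQ (e ▸ hT hz)
      rcases hx with rfl | hx <;> rcases hy with rfl | hy
      · simp [hNi]
      · simp only [if_true, if_neg (hne hy), (hNQ y (hT hy)).1]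
        ring
      · simp only [if_true, if_neg (hne hx), (hNQ x (hT hx)).2]
        field_simp
      · simp only [if_neg (hne hx), if_neg (hne hy), hN x (hQ (hT hx)) y (hQ (hT hy))]
        ring
  rcases T.eq_empty_or_nonempty with rfl | hT0
  · refine pminor_congr ?_
    intro x hx y hy
    simp only [Finset.union_empty, Finset.mem_insert] at hx hy
    rcases hx with rfl | hx <;> rcases hy with rfl | hy
    · exact hNi.symm
    · exact (hNP y (hS hy)).1.symm
    · exact (hNP x (hS hx)).2.symm
    · exact (hN x (hP (hS hx)) y (hP (hS hy))).symm
  obtain ⟨k, hk⟩ := hS0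
  obtain ⟨l, hl⟩ := hT0
  have hSc := Finset.card_pos.2 ⟨k, hk⟩
  have hTc := Finset.card_pos.2 ⟨l, hl⟩
  have hki : k ≠ i := fun e => hiP (e ▸ hS hk)
  have hli : l ≠ i := fun e => hiQ (e ▸ hT hl)
  have hkl : k ≠ l := fun e => hdis (hS hk) (e ▸ hT hl)
  have hmS : pminor M (insert i S) = pminor N (insert i S) := by
    have := ih _ (by simp; omega) S ∅ hS (by simp) rfl
    rwa [Finset.union_empty] at this
  have hmT : pminor M (insert i T) = pminor N (insert i T) := by
    have := ih _ (by simp; omega) ∅ T (by simp) hT rfl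
    rwa [Finset.empty_union] at this
  -- Two elements are needed so that replacing `S` by `{k}` gives a smaller instance.
  by_cases hS2 : 2 ≤ S.card
  · have e : insert i (S ∪ T) = S ∪ insert i T := by
      ext x; simp only [Finset.mem_insert, Finset.mem_union]; tauto
    rw [e]
    have hc : ∀ x ∈ P, ∀ y ∈ insert i Q, N x y = M x y ∧ N y x = M y x := by
      intro x hx y hy
      rcases Finset.mem_insert.1 hy with rfl | hy
      · simp [hNP x hx]
      · simp [hN x (hP hx) y (hQ hy), hN y (hQ hy) x (hP hx)]
    have hM1 : RankOneAcross M P (insert i Q) := by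
      refine .of_eq_mul (fun x => M x i) (fun y => if y = i then 1 else α * M i y) ?_
      intro x hx y hy
      rcases Finset.mem_insert.1 hy with rfl | hy
      · simp
      · rw [if_neg (show ¬ y = i from fun e => hiQ (e ▸ hy)), (hr x hx y hy).1]; ring
    have hM2 : RankOneAcross Mᵀ P (insert i Q) := by
      refine .of_eq_mul (fun x => M i x) (fun y => if y = i then 1 else β * M y i) ?_
      intro x hx y hy
      rw [transpose_apply]
      rcases Finset.mem_insert.1 hy with rfl | hy
      · simp
      · rw [if_neg (show ¬ y = i from fun e => hiQ (e ▸ hy)), (hr x hx y hy).2]; ring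
    refine pminor_union_eq (M := M) (N := N) (p := k) (q := i) ?_ hM1 hM2 ?_ ?_ (hS hk)
      (Finset.mem_insert_self _ _) (hM _ _ hki) (hM _ _ hki.symm) (hN k (hP (hS hk)) k
      (hP (hS hk))).symm hNi.symm ?_ hS (Finset.insert_subset_insert _ hT) ?_ hmT hmS ?_
    · exact Finset.disjoint_insert_right.2 ⟨hiP, hPQ⟩
    · intro x hx p hp y hy q hq
      rw [(hc x hx y hy).1, (hc p hp q hq).1, (hc x hx q hq).1, (hc p hp y hy).1]
      exact hM1 x hx p hp y hy q hq
    · intro x hx p hp y hy q hq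
      simp only [transpose_apply]
      rw [(hc x hx y hy).2, (hc p hp q hq).2, (hc x hx q hq).2, (hc p hp y hy).2]
      exact hM2 x hx p hp y hy q hq
    · rw [(hNP k (hS hk)).1, (hNP k (hS hk)).2]
    · exact pminor_congr fun x hx y hy => (hN x (hP (hS hx)) y (hP (hS hy))).symm
    · have := ih _ (by rw [Finset.card_singleton]; omega) {k} T (by simpa using hS hk) hT rfl
      rwa [Finset.insert_comm, Finset.insert_eq k]
  by_cases hT2 : 2 ≤ T.card
  · have e : insert i (S ∪ T) = T ∪ insert i S := by
      ext x; simp only [Finset.mem_insert, Finset.mem_union]; tauto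
    rw [e]
    have hM1 : RankOneAcross M Q (insert i P) := by
      refine .of_eq_mul (fun x => M x i) (fun y => if y = i then 1 else β * M i y) ?_
      intro x hx y hy
      rcases Finset.mem_insert.1 hy with rfl | hy
      · simp
      · rw [if_neg (show ¬ y = i from fun e => hiP (e ▸ hy)), (hr y hy x hx).2]; ring
    have hM2 : RankOneAcross Mᵀ Q (insert i P) := by
      refine .of_eq_mul (fun x => M i x) (fun y => if y = i then 1 else α * M y i) ?_
      intro x hx y hy
      rw [transpose_apply]
      rcases Finset.mem_insert.1 hy with rfl | hy
      · simp
      · rw [if_neg (show ¬ y = i from fun e => hiP (e ▸ hy)), (hr y hy x hx).1]; ring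
    have hN1 : RankOneAcross N Q (insert i P) := by
      refine .of_eq_mul (fun x => N x i) (fun y => if y = i then 1 else α * M i y) ?_
      intro x hx y hy
      rcases Finset.mem_insert.1 hy with rfl | hy
      · simp
      · rw [if_neg (show ¬ y = i from fun e => hiP (e ▸ hy)), hN x (hQ hx) y (hP hy), (hr y hy x hx).2,
          (hNQ x hx).2]
        field_simp
    have hN2 : RankOneAcross Nᵀ Q (insert i P) := by
      refine .of_eq_mul (fun x => N i x) (fun y => if y = i then 1 else β * M y i) ?_
      intro x hx y hy
      rw [transpose_apply]
      rcases Finset.mem_insert.1 hy with rfl | hy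
      · simp
      · rw [if_neg (show ¬ y = i from fun e => hiP (e ▸ hy)), hN y (hP hy) x (hQ hx), (hr y hy x hx).1,
          (hNQ x hx).1]
        field_simp
    refine pminor_union_eq (M := M) (N := N) (p := l) (q := i) ?_ hM1 hM2 hN1 hN2 (hT hl)
      (Finset.mem_insert_self _ _) (hM _ _ hli) (hM _ _ hli.symm) (hN l (hQ (hT hl)) l
      (hQ (hT hl))).symm hNi.symm ?_ hT (Finset.insert_subset_insert _ hS) ?_ hmS hmT ?_
    · exact Finset.disjoint_insert_right.2 ⟨hiQ, hPQ.symm⟩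
    · rw [(hNQ l (hT hl)).1, (hNQ l (hT hl)).2]
      field_simp
    · exact pminor_congr fun x hx y hy => (hN x (hQ (hT hx)) y (hQ (hT hy))).symm
    · have := ih _ (by rw [Finset.card_singleton]; omega) S {l} hS (by simpa using hT hl) rfl
      rwa [show insert l (insert i S) = insert i (S ∪ {l}) by
        ext x; simp only [Finset.mem_insert, Finset.mem_union, Finset.mem_singleton]; tauto]
  obtain rfl : S = {k} := Finset.eq_singleton_iff_unique_mem.2
    ⟨hk, fun x hx => Finset.card_le_one.1 (by omega) x hx k hk⟩
  obtain rfl : T = {l} := Finset.eq_singleton_iff_unique_mem.2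
    ⟨hl, fun x hx => Finset.card_le_one.1 (by omega) x hx l hl⟩
  have hk' := hS hk
  have hl' := hT hl
  rw [show insert i ({k} ∪ {l} : Finset V) = {i, k, l} from rfl,
    pminor_triple _ hki.symm hli.symm hkl, pminor_triple _ hki.symm hli.symm hkl, hNi,
    hN k (hP hk') k (hP hk'), hN l (hQ hl') l (hQ hl'), hN k (hP hk') l (hQ hl'),
    hN l (hQ hl') k (hP hk'), (hNP k hk').1, (hNP k hk').2, (hNQ l hl').1, (hNQ l hl').2,
    (hr k hk' l hl').1, (hr k hk' l hl').2]
  field_simp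
  ring

/-- For `i ∈ S` and `k ∉ S`, the matrix that agrees with `A` on `S ∪ {k}` and on `Sᶜ ∪ {i}` and
whose off-diagonal blocks with respect to `S` have rank at most one. -/
def cutMatrix (A : Matrix V V F) (S : Finset V) (i k : V) : Matrix V V F :=
  of fun x y => if x ∈ S then if y ∈ S then A x y else A x k * A i y / A i k
    else if y ∈ S then A k y * A x i / A k i else A x y

/-- Every pair of pairs separated by `S` satisfies one of the two alternatives that property `P`
leaves to a dense matrix. -/
def QuartetDichotomy (A : Matrix V V F) (S : Finset V) : Prop :=
  ∀ i ∈ S, ∀ j ∈ S, ∀ k ∉ S, ∀ l ∉ S, i ≠ j → k ≠ l → SplitsPairs A i j k l ∨ SplitsCross A i j k l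

variable {A : Matrix V V F} {S : Finset V}

lemma cutMatrix_of_mem {i k x y : V} (hx : x ∈ S) (hy : y ∈ S) :
    cutMatrix A S i k x y = A x y := by simp [cutMatrix, hx, hy]

lemma cutMatrix_of_notMem {i k x y : V} (hx : x ∉ S) (hy : y ∉ S) :
    cutMatrix A S i k x y = A x y := by simp [cutMatrix, hx, hy]

lemma cutMatrix_of_mem_of_notMem {i k x y : V} (hx : x ∈ S) (hy : y ∉ S) :
    cutMatrix A S i k x y = A x k * A i y / A i k := by simp [cutMatrix, hx, hy]

lemma cutMatrix_of_notMem_of_mem {i k x y : V} (hx : x ∉ S) (hy : y ∈ S) :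
    cutMatrix A S i k x y = A k y * A x i / A k i := by simp [cutMatrix, hx, hy]

lemma cutMatrix_diag {i k : V} (x : V) : cutMatrix A S i k x x = A x x := by
  by_cases hx : x ∈ S
  · exact cutMatrix_of_mem hx hx
  · exact cutMatrix_of_notMem hx hx

lemma rankOneAcross_cutMatrix [Fintype V] (A : Matrix V V F) (S : Finset V) (i k : V) :
    RankOneAcross (cutMatrix A S i k) S Sᶜ ∧ RankOneAcross (cutMatrix A S i k)ᵀ S Sᶜ := by
  constructor
  · refine .of_eq_mul (fun x => A x k) (fun y => A i y / A i k) fun x hx y hy => ?_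
    rw [cutMatrix_of_mem_of_notMem hx (Finset.mem_compl.1 hy)]
    ring
  · refine .of_eq_mul (fun x => A k x) (fun y => A y i / A k i) fun x hx y hy => ?_
    rw [transpose_apply, cutMatrix_of_notMem_of_mem (Finset.mem_compl.1 hy) hx]
    ring

lemma cutMatrix_right (hA : IsDense A) {i k : V} (hi : i ∈ S) (hk : k ∉ S) {x : V} (hx : x ∈ S) :
    cutMatrix A S i k x k = A x k ∧ cutMatrix A S i k k x = A k x := by
  have h1 := hA i k (fun e => hk (e ▸ hi))
  have h2 := hA k i (fun e => hk (e ▸ hi))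
  rw [cutMatrix_of_mem_of_notMem hx hk, cutMatrix_of_notMem_of_mem hk hx]
  constructor <;> field_simp

lemma cutMatrix_left (hA : IsDense A) {i k : V} (hi : i ∈ S) (hk : k ∉ S) {y : V} (hy : y ∉ S) :
    cutMatrix A S i k i y = A i y ∧ cutMatrix A S i k y i = A y i := by
  have h1 := hA i k (fun e => hk (e ▸ hi))
  have h2 := hA k i (fun e => hk (e ▸ hi))
  rw [cutMatrix_of_mem_of_notMem hi hy, cutMatrix_of_notMem_of_mem hy hi]
  constructor <;> field_simp

/-- Split `T` according to whether `ij|kl` is a cut. On the part `P` where it is, `cutMatrix` agrees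
with `A` in row and column `i`; on the rest `Q` the cross relations make it a constant rescaling of
`A`. Elements of `P` and `Q` are again in cross position, which gives the hypothesis of
`pminor_insert_union_eq_of_rescale`. -/
lemma pminor_cutMatrix_insert [Fintype V] (hA : IsDense A) (hS : QuartetDichotomy A S) {i j k : V}
    (hi : i ∈ S) (hj : j ∈ S) (hk : k ∉ S) {T : Finset V} (hT : ∀ x ∈ T, x ∉ S) :
    pminor A (insert i T) = pminor (cutMatrix A S j k) (insert i T) := by
  classical
  have ne : ∀ {x y}, x ∈ S → y ∉ S → x ≠ y := fun hx hy e => hy (e ▸ hx)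
  rcases eq_or_ne i j with rfl | hij
  · refine pminor_congr fun x hx y hy => ?_
    rw [Finset.mem_insert] at hx hy
    rcases hx with rfl | hx <;> rcases hy with rfl | hy
    · exact (cutMatrix_diag _).symm
    · exact (cutMatrix_left hA hi hk (hT y hy)).1.symm
    · exact (cutMatrix_left hA hi hk (hT x hx)).2.symm
    · exact (cutMatrix_of_notMem (hT x hx) (hT y hy)).symm
  have nij := hA i j hij
  have nji := hA j i hij.symm
  have n1 : ∀ {x}, x ∉ S → A i x ≠ 0 := fun h => hA _ _ (ne hi h)
  have n2 : ∀ {x}, x ∉ S → A x i ≠ 0 := fun h => hA _ _ (ne hi h).symm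
  have n3 : ∀ {x}, x ∉ S → A j x ≠ 0 := fun h => hA _ _ (ne hj h)
  have n4 : ∀ {x}, x ∉ S → A x j ≠ 0 := fun h => hA _ _ (ne hj h).symm
  have nik := n1 hk
  have nki := n2 hk
  have njk := n3 hk
  have nkj := n4 hk
  set P := T.filter fun l => SplitsPairs A i j k l with hP
  set Q := T.filter fun l => ¬ SplitsPairs A i j k l with hQ
  have hPm : ∀ l ∈ P, l ∉ S ∧ SplitsPairs A i j k l := fun l hl =>
    ⟨hT l (Finset.mem_filter.1 hl).1, (Finset.mem_filter.1 hl).2⟩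
  have hQm : ∀ l ∈ Q, l ∉ S ∧ ¬ SplitsPairs A i j k l := fun l hl =>
    ⟨hT l (Finset.mem_filter.1 hl).1, (Finset.mem_filter.1 hl).2⟩
  have hQc : ∀ l ∈ Q, SplitsCross A i j k l := fun l hl =>
    (hS i hi j hj k hk l (hQm l hl).1 hij
      (by rintro rfl; exact (hQm _ hl).2 ⟨rfl, mul_comm _ _⟩)).resolve_left (hQm l hl).2
  have hPQc : ∀ m ∈ P, ∀ l ∈ Q, SplitsCross A i j m l := by
    intro m hm l hl
    obtain ⟨hmS, hm1, hm2⟩ := hPm m hm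
    have key : ¬ SplitsPairs A i j m l := by
      rintro ⟨h1, h2⟩
      refine (hQm l hl).2 ⟨?_, ?_⟩
      · apply mul_left_cancel₀ (n1 hmS)
        linear_combination A i k * h1 + A i l * hm1
      · apply mul_left_cancel₀ (n2 hmS)
        linear_combination A k i * h2 + A l i * hm2
    refine (hS i hi j hj m hmS l (hQm l hl).1 hij ?_).resolve_left key
    rintro rfl
    exact key ⟨rfl, mul_comm _ _⟩
  have hTPQ : P ∪ Q = T := Finset.filter_union_filter_not_eq _ _
  have hi' : i ∉ T := fun h => hT i h hi
  have hPQT : ∀ x ∈ P ∪ Q, x ∉ S := fun x hx => hT x (hTPQ ▸ hx)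
  rw [← hTPQ]
  -- For `m ∈ P`, `l ∈ Q` the cross relation gives `A m l = A i l * A m j / A i j`, and `A m j / A m
  -- i = A k j / A k i` because `ij|km` is a cut; this is `α`. Transposing gives `β`.
  refine pminor_insert_union_eq_of_rescale (P := P) (Q := Q) (α := A k j / (A i j * A k i))
    (β := A j k / (A j i * A i k)) hA (fun h => hi' (Finset.mem_filter.1 h).1)
    (fun h => hi' (Finset.mem_filter.1 h).1) (Finset.disjoint_filter_filter_not _ _ _)
    (by positivity) (by positivity) ?_
    (fun x hx y hy => cutMatrix_of_notMem (hPQT x hx) (hPQT y hy)) (cutMatrix_diag _) ?_ ?_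
    P Q subset_rfl subset_rfl
  · intro m hm l hl
    obtain ⟨hmS, hm1, hm2⟩ := hPm m hm
    obtain ⟨⟨h1, h2⟩, h3, h4⟩ := hPQc m hm l hl
    constructor
    · field_simp
      linear_combination A k i * h1 + A i l * hm2
    · field_simp
      linear_combination A i k * h2 + A l i * hm1
  · intro m hm
    obtain ⟨hmS, hm1, hm2⟩ := hPm m hm
    rw [cutMatrix_of_mem_of_notMem hi hmS, cutMatrix_of_notMem_of_mem hmS hi]
    constructor
    · field_simp
      linear_combination hm1
    · field_simp
      linear_combination hm2
  · intro l hl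
    have hlS := (hQm l hl).1
    obtain ⟨⟨h1, h2⟩, h3, h4⟩ := hQc l hl
    rw [cutMatrix_of_mem_of_notMem hi hlS, cutMatrix_of_notMem_of_mem hlS hi]
    constructor
    · field_simp
      linear_combination A j i * h1 - A i j * h4
    · field_simp
      linear_combination A i j * h2 - A j i * h3

lemma cutMatrix_base_left [Fintype V] (hA : IsDense A) (hS : QuartetDichotomy A S) {i j k : V}
    (hi : i ∈ S) (hj : j ∈ S) (hk : k ∉ S) (T : Finset V) :
    pminor (cutMatrix A S i k) T = pminor (cutMatrix A S j k) T := by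
  have ne : ∀ {x y}, x ∈ S → y ∉ S → x ≠ y := fun hx hy e => hy (e ▸ hx)
  have hT : T = T ∩ S ∪ T \ S := by
    ext x; simp only [Finset.mem_union, Finset.mem_inter, Finset.mem_sdiff]; tauto
  have hin : ∀ x ∈ T ∩ S, x ∈ S := fun x hx => (Finset.mem_inter.1 hx).2
  have hout : ∀ x ∈ T \ S, x ∉ S := fun x hx => (Finset.mem_sdiff.1 hx).2
  have e1 := cutMatrix_right hA hi hk hi
  have e2 := cutMatrix_right hA hj hk hi
  rw [hT]
  refine pminor_union_eq (K := S) (L := Sᶜ) (p := i) (q := k) disjoint_compl_right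
    (rankOneAcross_cutMatrix A S i k).1 (rankOneAcross_cutMatrix A S i k).2
    (rankOneAcross_cutMatrix A S j k).1 (rankOneAcross_cutMatrix A S j k).2
    hi (Finset.mem_compl.2 hk) ?_ ?_ ?_ ?_ ?_ hin
    (fun x hx => Finset.mem_compl.2 (hout x hx)) ?_ ?_ ?_ ?_
  · rw [e1.1]; exact hA _ _ (ne hi hk)
  · rw [e1.2]; exact hA _ _ (ne hi hk).symm
  · rw [cutMatrix_diag, cutMatrix_diag]
  · rw [cutMatrix_diag, cutMatrix_diag]
  · rw [e1.1, e1.2, e2.1, e2.2]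
  · exact pminor_congr fun x hx y hy => by
      rw [cutMatrix_of_mem (hin x hx) (hin y hy), cutMatrix_of_mem (hin x hx) (hin y hy)]
  · exact pminor_congr fun x hx y hy => by
      rw [cutMatrix_of_notMem (hout x hx) (hout y hy), cutMatrix_of_notMem (hout x hx) (hout y hy)]
  · refine pminor_congr fun x hx y hy => ?_
    rw [Finset.mem_insert] at hx hy
    rcases hx with rfl | hx <;> rcases hy with rfl | hy
    · rw [cutMatrix_diag, cutMatrix_diag]
    · rw [(cutMatrix_right hA hi hk (hin y hy)).2, (cutMatrix_right hA hj hk (hin y hy)).2]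
    · rw [(cutMatrix_right hA hi hk (hin x hx)).1, (cutMatrix_right hA hj hk (hin x hx)).1]
    · rw [cutMatrix_of_mem (hin x hx) (hin y hy), cutMatrix_of_mem (hin x hx) (hin y hy)]
  -- The only minor on which the two matrices differ visibly; both values equal that of `A`.
  · rw [← pminor_cutMatrix_insert hA hS hi hi hk hout, ← pminor_cutMatrix_insert hA hS hi hj hk hout]

lemma QuartetDichotomy.compl [Fintype V] (hS : QuartetDichotomy A S) : QuartetDichotomy A Sᶜ := by
  intro i hi j hj k hk l hl hij hkl
  rw [Finset.mem_compl] at hi hj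
  rw [Finset.mem_compl, not_not] at hk hl
  rcases hS k hk l hl i hi j hj hkl hij with h | ⟨h1, h2⟩
  · exact Or.inl h.symm
  · exact Or.inr ⟨h1.swap, h2.symm.swap⟩

/-- This symmetry turns a change of `k` into a change of `i`. -/
lemma cutMatrix_compl [Fintype V] (A : Matrix V V F) (S : Finset V) (i k : V) :
    cutMatrix A Sᶜ k i = cutMatrix A S i k := by
  ext x y
  by_cases hx : x ∈ S <;> by_cases hy : y ∈ S <;> simp [cutMatrix, hx, hy, mul_comm]

lemma cutMatrix_base [Fintype V] (hA : IsDense A) (hS : QuartetDichotomy A S) {i j k l : V}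
    (hi : i ∈ S) (hj : j ∈ S) (hk : k ∉ S) (hl : l ∉ S) (T : Finset V) :
    pminor (cutMatrix A S i k) T = pminor (cutMatrix A S j l) T := by
  rw [cutMatrix_base_left hA hS hi hj hk, ← cutMatrix_compl A S j k, ← cutMatrix_compl A S j l]
  exact cutMatrix_base_left hA hS.compl (Finset.mem_compl.2 hk) (Finset.mem_compl.2 hl)
    (by simpa using hj) T

end BaseChange

/-! ### Components of unsplit quartets and the main induction -/

section Components

variable {V F : Type*} [Field F] {A : Matrix V V F} {S : Finset V} {i k : V}

/-- `x` and `y` lie on different sides of `S`, and together with `i` and `k` they witness that `S`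
does not split `A`. -/
def CrossAdj (A : Matrix V V F) (S : Finset V) (i k x y : V) : Prop :=
  (x ∈ S ∧ y ∉ S ∧ ¬ SplitsPairs A i x k y) ∨ (y ∈ S ∧ x ∉ S ∧ ¬ SplitsPairs A i y k x)

lemma crossAdj_transpose (A : Matrix V V F) (S : Finset V) (i k : V) :
    CrossAdj Aᵀ S i k = CrossAdj A S i k := by
  funext x y
  simp only [CrossAdj, splitsPairs_transpose]

lemma not_crossAdj_left (hi : i ∈ S) (x : V) : ¬ CrossAdj A S i k x i := by
  rintro (⟨_, h, _⟩ | ⟨_, _, h⟩)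
  · exact h hi
  · exact h ⟨mul_comm _ _, rfl⟩

lemma not_crossAdj_right (hk : k ∉ S) (x : V) : ¬ CrossAdj A S i k x k := by
  rintro (⟨_, _, h⟩ | ⟨h, _, _⟩)
  · exact h ⟨rfl, mul_comm _ _⟩
  · exact hk h

lemma QuartetDichotomy.transpose (hS : QuartetDichotomy A S) : QuartetDichotomy Aᵀ S := by
  intro i hi j hj k hk l hl hij hkl
  simpa only [SplitsCross, splitsPairs_transpose] using hS i hi j hj k hk l hl hij hkl

/-- The two ends of an edge of `CrossAdj` have proportional rows outside its component. -/
lemma mul_eq_mul_of_crossAdj (hA : IsDense A) (hS : QuartetDichotomy A S) (hi : i ∈ S)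
    (hk : k ∉ S) {x y z : V} (hxy : CrossAdj A S i k x y) (hzx : z ≠ x) (hzy : z ≠ y)
    (hx : ¬ CrossAdj A S i k x z) (hy : ¬ CrossAdj A S i k y z) :
    A x z * A y k = A x k * A y z := by
  wlog hxS : x ∈ S generalizing x y
  · have hyS : y ∈ S := by
      rcases hxy with h | h
      · exact absurd h.1 hxS
      · exact h.1
    have := this (x := y) (y := x) (hxy.symm) hzy hzx hy hx hyS
    linear_combination -this
  have ne : ∀ {x y}, x ∈ S → y ∉ S → x ≠ y := fun hx hy e => hy (e ▸ hx)
  obtain ⟨hyS, hsp⟩ : y ∉ S ∧ ¬ SplitsPairs A i x k y := by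
    rcases hxy with h | h
    · exact h.2
    · exact absurd hxS h.2.1
  have hky : k ≠ y := by
    rintro rfl
    exact hsp ⟨rfl, mul_comm _ _⟩
  have hix : i ≠ x := by
    rintro rfl
    exact hsp ⟨mul_comm _ _, rfl⟩
  -- Splitting is transitive in each pair, so one split and one unsplit quartet yield a further
  -- unsplit one, to which the cross relations apply. If `z ∈ S`, those of `zx|ky` contain the
  -- claim. If `z ∉ S`, those of `ix|zy` and `ix|ky` give it after eliminating `A x i` and `A y i`.
  by_cases hzS : z ∈ S
  · have hz : SplitsPairs A i z k y := by
      by_contra h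
      exact hy (Or.inr ⟨hzS, hyS, h⟩)
    have hn : ¬ SplitsPairs A z x k y := by
      rintro ⟨h1, h2⟩
      refine hsp ⟨?_, ?_⟩
      · apply mul_left_cancel₀ (hA z k (ne hzS hk))
        linear_combination A i k * h1 + A x k * hz.1
      · apply mul_left_cancel₀ (hA k z (ne hzS hk).symm)
        linear_combination A k i * h2 + A k x * hz.2
    exact ((hS z hzS x hxS k hk y hyS hzx hky).resolve_left hn).1.2
  · have hz : SplitsPairs A i x k z := by
      by_contra h
      exact hx (Or.inl ⟨hxS, hzS, h⟩)
    have hn : ¬ SplitsPairs A i x z y := by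
      rintro ⟨h1, h2⟩
      refine hsp ⟨?_, ?_⟩
      · apply mul_left_cancel₀ (hA i z (ne hi hzS))
        linear_combination A i k * h1 + A i y * hz.1
      · apply mul_left_cancel₀ (hA z i (ne hi hzS).symm)
        linear_combination A k i * h2 + A y i * hz.2
    have h1 := ((hS i hi x hxS z hzS y hyS hix hzy).resolve_left hn).1.2
    have h2 := ((hS i hi x hxS k hk y hyS hix hky).resolve_left hsp).1.2
    apply mul_left_cancel₀ (hA y i (ne hi hyS).symm)
    linear_combination A y z * h2 - A y k * h1

/-- Proportionality of rows outside `K` propagates from `x₀` along paths, with column `k` as the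
normalisation. -/
lemma rankOneAcross_component [Fintype V] [DecidableEq V] (hA : IsDense A)
    (hS : QuartetDichotomy A S) (hi : i ∈ S) (hk : k ∉ S) {K : Finset V} {x₀ : V}
    (hK : ∀ x, x ∈ K ↔ Relation.ReflTransGen (CrossAdj A S i k) x₀ x) (hkK : k ∉ K) :
    RankOneAcross A K Kᶜ := by
  have hx₀ : x₀ ∈ K := (hK _).2 .refl
  have hclosed : ∀ {x y}, x ∈ K → CrossAdj A S i k x y → y ∈ K := fun hx h =>
    (hK _).2 (((hK _).1 hx).tail h)
  have hne : ∀ {x}, x ∈ K → A x k ≠ 0 := fun hx => hA _ _ fun e => hkK (e ▸ hx)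
  have key : ∀ x, Relation.ReflTransGen (CrossAdj A S i k) x₀ x →
      ∀ y ∉ K, A x y * A x₀ k = A x k * A x₀ y := by
    intro x hx
    induction hx with
    | refl => intro y _; ring
    | @tail b c hb hbc ih =>
      intro y hy
      have hbK := (hK _).2 hb
      have hcK := hclosed hbK hbc
      have h := mul_eq_mul_of_crossAdj hA hS hi hk (z := y) hbc (fun e => hy (e ▸ hbK))
        (fun e => hy (e ▸ hcK)) (fun e => hy (hclosed hbK e)) (fun e => hy (hclosed hcK e))
      apply mul_left_cancel₀ (hne hbK)
      linear_combination A c k * ih y hy - A x₀ k * h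
  refine .of_eq_mul (fun x => A x k) (fun y => A x₀ y / A x₀ k) fun x hx y hy => ?_
  have := key x ((hK x).1 hx) y (Finset.mem_compl.1 hy)
  have := hne hx₀
  field_simp
  assumption

variable [DecidableEq V]

lemma cutMatrix_eq_of_splitsPairs (hA : IsDense A) (hi : i ∈ S) (hk : k ∉ S) {x y : V}
    (hx : x ∈ S) (hy : y ∉ S) (h : SplitsPairs A i x k y) :
    cutMatrix A S i k x y = A x y ∧ cutMatrix A S i k y x = A y x := by
  have h1 := hA i k (fun e => hk (e ▸ hi))
  have h2 := hA k i (fun e => hk (e ▸ hi))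
  rw [cutMatrix_of_mem_of_notMem hx hy, cutMatrix_of_notMem_of_mem hy hx]
  constructor
  · field_simp
    linear_combination -h.1
  · field_simp
    linear_combination -h.2

lemma cutMatrix_eq_of_not_crossAdj (hA : IsDense A) (hi : i ∈ S) (hk : k ∉ S) {x y : V}
    (h : ¬ CrossAdj A S i k x y) :
    cutMatrix A S i k x y = A x y ∧ cutMatrix A S i k y x = A y x := by
  by_cases hx : x ∈ S <;> by_cases hy : y ∈ S
  · exact ⟨cutMatrix_of_mem hx hy, cutMatrix_of_mem hy hx⟩
  · refine cutMatrix_eq_of_splitsPairs hA hi hk hx hy ?_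
    by_contra h'
    exact h (Or.inl ⟨hx, hy, h'⟩)
  · refine (cutMatrix_eq_of_splitsPairs hA hi hk hy hx ?_).symm
    by_contra h'
    exact h (Or.inr ⟨hy, hx, h'⟩)
  · exact ⟨cutMatrix_of_notMem hx hy, cutMatrix_of_notMem hy hx⟩

/-- Strong induction on `T`, with `i` and `k` free so that they can be moved into `T`. -/
theorem pminor_cutMatrix [Fintype V] (hA : IsDense A) (hS : QuartetDichotomy A S) (hi : i ∈ S)
    (hk : k ∉ S) (T : Finset V) : pminor (cutMatrix A S i k) T = pminor A T := by
  classical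
  induction T using Finset.strongInduction generalizing i k with
  | H T ih =>
  by_cases h₁ : ∀ x ∈ T, x ∉ S
  · exact pminor_congr fun x hx y hy => cutMatrix_of_notMem (h₁ x hx) (h₁ y hy)
  by_cases h₂ : ∀ x ∈ T, x ∈ S
  · exact pminor_congr fun x hx y hy => cutMatrix_of_mem (h₂ x hx) (h₂ y hy)
  push Not at h₁ h₂
  obtain ⟨i₀, hi₀T, hi₀⟩ := h₁
  obtain ⟨k₀, hk₀T, hk₀⟩ := h₂
  rw [cutMatrix_base hA hS hi hi₀ hk hk₀]
  by_cases h₃ : ∀ x ∈ T, ∀ y ∈ T, ¬ CrossAdj A S i₀ k₀ x y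
  · exact pminor_congr fun x hx y hy =>
      (cutMatrix_eq_of_not_crossAdj hA hi₀ hk₀ (h₃ x hx y hy)).1
  push Not at h₃
  obtain ⟨x, hxT, y, hyT, hxy⟩ := h₃
  have hyx : CrossAdj A S i₀ k₀ y x := hxy.symm
  -- The component is taken in all of `V`, not only in `T`. The base points `i₀`, `k₀` are isolated,
  -- hence outside it.
  set K : Finset V := Finset.univ.filter (Relation.ReflTransGen (CrossAdj A S i₀ k₀) x) with hKdef
  have hK : ∀ z, z ∈ K ↔ Relation.ReflTransGen (CrossAdj A S i₀ k₀) x z := by simp [hKdef]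
  have hxK : x ∈ K := (hK _).2 .refl
  have hyK : y ∈ K := (hK _).2 (.single hxy)
  have hxi : x ≠ i₀ := by
    rintro rfl
    exact not_crossAdj_left hi₀ y hyx
  have hxk : x ≠ k₀ := by
    rintro rfl
    exact not_crossAdj_right hk₀ y hyx
  have hi₀K : i₀ ∉ K := fun h => by
    rcases Relation.ReflTransGen.cases_tail ((hK _).1 h) with h | ⟨b, -, h⟩
    · exact hxi h.symm
    · exact not_crossAdj_left hi₀ b h
  have hk₀K : k₀ ∉ K := fun h => by
    rcases Relation.ReflTransGen.cases_tail ((hK _).1 h) with h | ⟨b, -, h⟩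
    · exact hxk h.symm
    · exact not_crossAdj_right hk₀ b h
  have hA' : RankOneAcross A K Kᶜ := rankOneAcross_component hA hS hi₀ hk₀ hK hk₀K
  have hA'' : RankOneAcross Aᵀ K Kᶜ :=
    rankOneAcross_component (A := Aᵀ) (fun a b hab => hA b a hab.symm) hS.transpose hi₀ hk₀
      (by rwa [crossAdj_transpose]) hk₀K
  have hC : ∀ a ∈ K, ∀ b ∈ Kᶜ,
      cutMatrix A S i₀ k₀ a b = A a b ∧ cutMatrix A S i₀ k₀ b a = A b a := fun a ha b hb =>
    cutMatrix_eq_of_not_crossAdj hA hi₀ hk₀ fun h =>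
      Finset.mem_compl.1 hb ((hK _).2 (((hK _).1 ha).tail h))
  have hk₀K' := Finset.mem_compl.2 hk₀K
  have hT : T = T ∩ K ∪ T \ K := by
    ext z; simp only [Finset.mem_union, Finset.mem_inter, Finset.mem_sdiff]; tauto
  have ssub : ∀ {T' : Finset V} {z}, T' ⊆ T → z ∈ T → z ∉ T' → T' ⊂ T := fun h hz hz' =>
    Finset.ssubset_iff_subset_ne.2 ⟨h, fun e => hz' (e ▸ hz)⟩
  have hik₀ : i₀ ≠ k₀ := fun e => hk₀ (e ▸ hi₀)
  have hyx' : y ≠ x := by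
    rintro rfl
    rcases hxy with h | h
    · exact h.2.1 h.1
    · exact h.2.1 h.1
  rw [hT]
  refine pminor_union_eq (K := K) (L := Kᶜ) (p := x) (q := k₀) disjoint_compl_right ?_ ?_ hA' hA''
    hxK hk₀K' ?_ ?_ (cutMatrix_diag _) (cutMatrix_diag _) ?_ Finset.inter_subset_right
    (fun z hz => Finset.mem_compl.2 (Finset.mem_sdiff.1 hz).2) ?_ ?_ ?_ ?_
  · intro a ha b hb c hc d hd
    rw [(hC a ha c hc).1, (hC b hb d hd).1, (hC a ha d hd).1, (hC b hb c hc).1]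
    exact hA' a ha b hb c hc d hd
  · intro a ha b hb c hc d hd
    simp only [transpose_apply]
    rw [(hC a ha c hc).2, (hC b hb d hd).2, (hC a ha d hd).2, (hC b hb c hc).2]
    exact hA'' a ha b hb c hc d hd
  · rw [(hC x hxK k₀ hk₀K').1]; exact hA _ _ hxk
  · rw [(hC x hxK k₀ hk₀K').2]; exact hA _ _ hxk.symm
  · rw [(hC x hxK k₀ hk₀K').1, (hC x hxK k₀ hk₀K').2]
  -- The four smaller sets are proper: they omit `i₀`, `x`, `i₀` and `y` respectively.
  · exact ih _ (ssub Finset.inter_subset_left hi₀T (by simp [hi₀K])) hi₀ hk₀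
  · exact ih _ (ssub Finset.sdiff_subset hxT (by simp [hxK])) hi₀ hk₀
  · exact ih _ (ssub (Finset.insert_subset hk₀T Finset.inter_subset_left) hi₀T
      (by simp [hi₀K, hik₀])) hi₀ hk₀
  · exact ih _ (ssub (Finset.insert_subset hxT Finset.sdiff_subset) hyT
      (by simp [hyK, hyx'])) hi₀ hk₀

end Components

/-! ### Restriction to four indices and the equivalence -/

lemma PME.principal {V F : Type*} [DecidableEq V] [Field F] {A C : Matrix V V F} (h : PME C A) (T : Finset V) :
    PME (principal C T) (principal A T) := by
  intro S
  have e : ∀ M : Matrix V V F, pminor M (S.map (Function.Embedding.subtype _)) =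
      (_root_.principal (_root_.principal M T) S).det := fun M =>
    pminor_eq_det_submatrix M (fun s : S => ((s : T) : V))
      (Subtype.val_injective.comp Subtype.val_injective) (by simp)
  rw [← e, ← e]
  exact h _

section Plausible

variable {V F : Type*} [Fintype V] [DecidableEq V] [Field F]

lemma isCut_cutMatrix (A : Matrix V V F) {S : Finset V} (i k : V) (h1 : 2 ≤ S.card)
    (h2 : S.card + 2 ≤ Fintype.card V) : IsCut (cutMatrix A S i k) S := by
  refine ⟨h1, h2, ?_, ?_⟩
  · have : block (cutMatrix A S i k) S Sᶜ =
        vecMulVec (fun x : S => A x k) (fun y : (Sᶜ : Finset V) => A i y / A i k) := by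
      ext x y
      simp only [block, submatrix_apply, vecMulVec_apply]
      rw [cutMatrix_of_mem_of_notMem x.2 (Finset.mem_compl.1 y.2), mul_div_assoc]
    rw [this]
    exact rank_vecMulVec_le _ _
  · have : block (cutMatrix A S i k) Sᶜ S =
        vecMulVec (fun y : (Sᶜ : Finset V) => A y i / A k i) (fun x : S => A k x) := by
      ext y x
      simp only [block, submatrix_apply, vecMulVec_apply]
      rw [cutMatrix_of_notMem_of_mem (Finset.mem_compl.1 y.2) x.2]
      ring
    rw [this]
    exact rank_vecMulVec_le _ _

lemma IsPlausible.quartetDichotomy {A : Matrix V V F} {S : Finset V} (hA : IsDense A)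
    (h : IsPlausible A S) : QuartetDichotomy A S := by
  intro i hi j hj k hk l hl hij hkl
  have ne : ∀ {x y}, x ∈ S → y ∉ S → x ≠ y := fun hx hy e => hy (e ▸ hx)
  exact (h.2.2 i hi j hj k (Finset.mem_compl.2 hk) l (Finset.mem_compl.2 hl) hij
    hkl).splitsPairs_or_splitsCross hA hij (ne hi hk) (ne hi hl) (ne hj hk) (ne hj hl) hkl

lemma IsCut.principal {C : Matrix V V F} {S : Finset V} (hC : IsCut C S) {T : Finset V}
    {Y : Finset T} (hY : ∀ x : T, x ∈ Y ↔ (x : V) ∈ S) (h1 : 2 ≤ Y.card)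
    (h2 : Y.card + 2 ≤ Fintype.card T) : IsCut (principal C T) Y := by
  let f : Y → S := fun x => ⟨(x : T), (hY x).1 x.2⟩
  let g : (Yᶜ : Finset T) → (Sᶜ : Finset V) := fun x =>
    ⟨(x : T), Finset.mem_compl.2 fun h => Finset.mem_compl.1 x.2 ((hY x).2 h)⟩
  exact ⟨h1, h2, (rank_submatrix_le (block C S Sᶜ) f g).trans hC.2.2.1,
    (rank_submatrix_le (block C Sᶜ S) g f).trans hC.2.2.2⟩

lemma IsCut.propertyP {A C : Matrix V V F} {S : Finset V} (h : PME C A) (hC : IsCut C S)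
    {i j k l : V} (hi : i ∈ S) (hj : j ∈ S) (hk : k ∈ Sᶜ) (hl : l ∈ Sᶜ) (hij : i ≠ j)
    (hkl : k ≠ l) : PropertyP A i j k l := by
  have ne : ∀ {x y}, x ∈ S → y ∈ Sᶜ → x ≠ y := fun hx hy e =>
    Finset.mem_compl.1 hy (e ▸ hx)
  unfold PropertyP
  set T : Finset V := {i, j, k, l} with hT
  have hmem : ∀ x : T, (x : V) = i ∨ (x : V) = j ∨ (x : V) = k ∨ (x : V) = l := fun x => by
    have : (x : V) ∈ ({i, j, k, l} : Finset V) := x.2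
    simpa only [Finset.mem_insert, Finset.mem_singleton] using this
  have hcard : (({i, j} : Finset V).subtype (fun v => v ∈ T)).card = 2 := by
    rw [Finset.card_subtype, Finset.filter_true_of_mem, Finset.card_pair hij]
    intro x hx
    simp only [hT, Finset.mem_insert, Finset.mem_singleton] at hx ⊢
    tauto
  refine ⟨_root_.principal C T, h.principal T, hC.principal ?_ hcard.ge ?_⟩
  · intro x
    rw [Finset.mem_subtype, Finset.mem_insert, Finset.mem_singleton]
    refine ⟨fun hx => by rcases hx with hx | hx <;> rwa [hx], fun hx => ?_⟩
    rcases hmem x with e | e | e | e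
    · exact Or.inl e
    · exact Or.inr e
    · exact absurd e (ne hx hk)
    · exact absurd e (ne hx hl)
  · rw [hcard, Fintype.card_coe, hT, Finset.card_insert_of_notMem, Finset.card_insert_of_notMem,
      Finset.card_pair hkl]
    · simp [ne hj hk, ne hj hl]
    · simp [hij, ne hi hk, ne hi hl]

/-- For dense matrices the rank-one extension property is not needed. -/
theorem isPlausible_iff_exists_cut {A : Matrix V V F} (hA : IsDense A) (S : Finset V) :
    IsPlausible A S ↔ ∃ C : Matrix V V F, PME C A ∧ IsCut C S := by
  constructor
  · intro h
    obtain ⟨i, hi⟩ := Finset.card_pos.1 (show 0 < S.card by have := h.1; omega)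
    obtain ⟨k, hk⟩ := Finset.card_pos.1
      (show 0 < Sᶜ.card by have := h.2.1; rw [Finset.card_compl]; omega)
    exact ⟨cutMatrix A S i k,
      pminor_cutMatrix hA (h.quartetDichotomy hA) hi (Finset.mem_compl.1 hk),
      isCut_cutMatrix A i k h.1 h.2.1⟩
  · rintro ⟨C, hPME, hC⟩
    exact ⟨hC.1, hC.2.1, fun i hi j hj k hk l hl hij hkl =>
      hC.propertyP hPME hi hj hk hl hij hkl⟩

end Plausible

end

theorem lemma5p14 {F : Type*} [Field F] (n : ℕ) (A : Matrix (Fin n) (Fin n) F)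
    (hA : PropertyR A) (S : Finset (Fin n)) :
    IsPlausible A S ↔ ∃ C : Matrix (Fin n) (Fin n) F, PME C A ∧ IsCut C S := by
  exact isPlausible_iff_exists_cut hA.1 S
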